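/- **Setting.** Alice has actions $A=\{1,\dots,m\}$, Bob has actions $B=\{1,\dots,n\}$ ($m,n,K\ge 1$), $\beta\in[0,1)$, and the vector losses satisfy $\mathbf r(a,b)\in[0,1-\beta]^K$. In the infinitely repeated game, behavioural strategies $\pi_A,\pi_B$ map each finite history of action pairs to mixed actions (the two players randomize independently in each stage), and $R_k(\pi_A,\pi_B)=\mathrm E\big[\sum_{t\ge1}\beta^{t-1}r_k(a_t,b_t)\big]$. A strategy $\pi_A$ has guarantee vector $\big(\max_{\pi_B}R_k(\pi_A,\pi_B)\big)_{k}$. Let $\mathcal W^\infty$ be the set of all guarantee vectors. For a set $\mathcal S$ let $\Lambda(\mathcal S)$ be the set of elements of $\mathcal S$ that are componentwise $\ge$ no other element of $\mathcal S$, and let $\mathcal V^\infty=\Lambda(\mathcal W^\infty)$. Let $\mathcal F$ be the family of non-empty sets $\mathcal V\subseteq[0,1]^K$ in which no two distinct elements are componentwise comparable and whose upset $\{\mathbf x\in[0,1]^K:\mathbf x\succeq\mathbf v\text{ for some }\mathbf v\in\mathcal V\}$ is closed and convex. For $\mathcal V\in\mathcal F$ let $\Phi(\mathcal V)=\Lambda(\Psi(\mathcal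 V))$, where $\Psi(\mathcal V)$ is the set of all vectors $\big(\max_{b}\sum_a\alpha_a[r_k(a,b)+\beta R_k(a,b)]\big)_k$ with $\boldsymbol\alpha\in\Delta(A)$ and $\mathbf R(a,b)\in\mathcal V$ for all $a,b$. Let $\mathcal P=\{\mathbf p\in[0,1]^K:\ p_k=0\text{ for some }k\}$, and for $\mathbf p\in\mathcal P$ let $\mathbf F(\mathbf p,\mathcal V)=t\mathbf 1+\mathbf p$ with the smallest $t\in\mathbb R$ such that $t\mathbf 1+\mathbf p\succeq\mathbf u$ for some $\mathbf u\in\mathcal V$. **Theorem.** The set $\mathcal P$ is compact; $\Phi$ has exactly one fixed point $\mathcal V^*$ in $\mathcal F$; and $\mathcal V^*=\mathcal V^\infty$. The minimum defining $\mathbf F(\mathbf p,\mathcal V^*)$ exists for every $\mathbf p\in\mathcal P$, and every $\mathbf u\in\mathcal V^*$ equals $\mathbf F(\mathbf p,\mathcal V^*)$ for exactly one $\mathbf p\in\mathcal P$. There are maps $\boldsymbol\alpha:\mathcal P\to\Delta(A)$ and $\mathbf q:B\times\mathcal P\to\mathcal P$ with $\mathbf F(\mathbf q(b,\mathbf p),\mathcal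 V^*)\in\mathcal V^*$ for all $b,\mathbf p$ and $$\max_{b\in B}\Big\{\sum_{a\in A}\alpha_a(\mathbf p)r_k(a,b)+\beta F_k(\mathbf q(b,\mathbf p),\mathcal V^*)\Big\}\le F_k(\mathbf p,\mathcal V^*)\qquad\text{for all }\mathbf p\in\mathcal P,\ k. \tag{1}$$ For all maps $\boldsymbol\alpha,\mathbf q$ that satisfy (1) and every $\mathbf p_1\in\mathcal P$, let $\sigma_{\mathbf p_1}$ be the stationary strategy that starts in state $\mathbf p_1$, plays $\boldsymbol\alpha(\mathbf p)$ whenever the current state is $\mathbf p$, and then moves to $\mathbf q(b,\mathbf p)$ when Bob has played $b$. Then: 1. $R_k(\sigma_{\mathbf p_1},\pi_B)\le F_k(\mathbf p_1,\mathcal V^*)$ for all $k$ and all strategies $\pi_B$ of Bob. 2. After every finite history $h$, leading to the state $\mathbf p_h$, the continuation of $\sigma_{\mathbf p_1}$ has expected discounted loss (discounted from that stage on) at most $F_k(\mathbf p_h,\mathcal V^*)$ in each component $k$, against every strategy of Bob. 3. If $\mathbf F(\mathbf p_1,\mathcal V^*)\in\mathcal V^*$, then (1) holds with equality at $\mathbf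 p=\mathbf p_1$, and the guarantee vector of $\sigma_{\mathbf p_1}$ is exactly $\mathbf F(\mathbf p_1,\mathcal V^*)$. 4. $\sigma_{\mathbf p_1}$ does not depend on Alice's own past actions. In particular, every point of $\mathcal V^\infty$ is attained by a strategy of Alice that ignores her own past actions and is stationary on the compact state space $\mathcal P$. -/

import Mathlib

open MeasureTheory ProbabilityTheory

namespace VectorGame

/-! Vectors of `ℝ^K` are functions `Fin K → ℝ` with the componentwise order; `Set.Icc 0 1` is the
cube `[0,1]^K`. Alice's actions are `Fin m`, Bob's are `Fin n`, and `stdSimplex ℝ (Fin m)` is the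
set of mixed actions of Alice. A history is the list, in chronological order, of the pairs
(Alice's action, Bob's action) played so far. -/

/-! ### The infinitely repeated discounted game -/

/-- A behavioural strategy of a player with `l` actions: a mixed action after every history. -/
abbrev Strategy (m n l : ℕ) : Type := List (Fin m × Fin n) → stdSimplex ℝ (Fin l)

/-- The probability measure on `Fin l` given by a mixed action. -/
noncomputable def mixedLaw {l : ℕ} (α : stdSimplex ℝ (Fin l)) : Measure (Fin l) :=
  ∑ a, ENNReal.ofReal (α a) • Measure.dirac a

instance mixedLaw_isProbabilityMeasure {l : ℕ} (α : stdSimplex ℝ (Fin l)) :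
    IsProbabilityMeasure (mixedLaw α) := by
  constructor
  have h1 : ∑ a, ENNReal.ofReal (α a) = 1 := by
    rw [← ENNReal.ofReal_sum_of_nonneg (fun a _ => show 0 ≤ α a from α.2.1 a), show ∑ a, α a = 1 from α.2.2, ENNReal.ofReal_one]
  simp [mixedLaw, h1]

/-- The law of the pair of actions played after the history `h`: the players randomize
independently of each other. -/
noncomputable def stageLaw {m n : ℕ} (πA : Strategy m n m) (πB : Strategy m n n)
    (h : List (Fin m × Fin n)) : Measure (Fin m × Fin n) :=
  (mixedLaw (πA h)).prod (mixedLaw (πB h))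

instance stageLaw_isProbabilityMeasure {m n : ℕ} (πA : Strategy m n m) (πB : Strategy m n n)
    (h : List (Fin m × Fin n)) : IsProbabilityMeasure (stageLaw πA πB h) := by
  unfold stageLaw; infer_instance

/-- The list of the first `t + 1` action pairs of a play. -/
def historyOf {m n : ℕ} (t : ℕ) (x : (i : Finset.Iic t) → Fin m × Fin n) :
    List (Fin m × Fin n) :=
  List.ofFn fun i : Fin (t + 1) => x ⟨i, Finset.mem_Iic.2 (Nat.lt_succ_iff.1 i.2)⟩

/-- The conditional law of the action pair at time `t + 1` given those at times `0, …, t`. -/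
noncomputable def stageKernel {m n : ℕ} (πA : Strategy m n m) (πB : Strategy m n n) (t : ℕ) :
    Kernel ((i : Finset.Iic t) → Fin m × Fin n) (Fin m × Fin n) where
  toFun x := stageLaw πA πB (historyOf t x)
  measurable' := measurable_of_countable _

instance stageKernel_isMarkovKernel {m n : ℕ} (πA : Strategy m n m) (πB : Strategy m n n)
    (t : ℕ) : IsMarkovKernel (stageKernel πA πB t) :=
  ⟨fun x => stageLaw_isProbabilityMeasure πA πB (historyOf t x)⟩

/-- The law of the infinite play `(a₀, b₀), (a₁, b₁), …` induced by a pair of strategies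
(Ionescu-Tulcea). -/
noncomputable def playLaw {m n : ℕ} (πA : Strategy m n m) (πB : Strategy m n n) :
    Measure (ℕ → Fin m × Fin n) :=
  Kernel.trajMeasure (X := fun _ => Fin m × Fin n) (stageLaw πA πB []) (stageKernel πA πB)

/-- The expected total discounted loss of Alice on component `k` (stages counted from `0`). -/
noncomputable def expectedLoss {m n K : ℕ} (β : ℝ) (r : Fin m → Fin n → Fin K → ℝ)
    (πA : Strategy m n m) (πB : Strategy m n n) (k : Fin K) : ℝ :=
  ∫ x, ∑' t : ℕ, β ^ t * r (x t).1 (x t).2 k ∂(playLaw πA πB)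

/-- `w` is the vector of simultaneous upper bounds that `πA` guarantees: in each component, the
maximum over the strategies of Bob of the expected loss. -/
def IsGuarantee {m n K : ℕ} (β : ℝ) (r : Fin m → Fin n → Fin K → ℝ)
    (πA : Strategy m n m) (w : Fin K → ℝ) : Prop :=
  ∀ k, IsGreatest (Set.range fun πB : Strategy m n n => expectedLoss β r πA πB k) (w k)

/-- The lower Pareto frontier of a set: its elements that dominate no other element of it. -/
def lowerFrontier {K : ℕ} (S : Set (Fin K → ℝ)) : Set (Fin K → ℝ) :=
  {x ∈ S | ∀ y ∈ S, y ≤ x → y = x}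

/-- The minimal vectors of simultaneous upper bounds that Alice can guarantee in the infinitely
repeated game. -/
def optimalFrontier {m n K : ℕ} (β : ℝ) (r : Fin m → Fin n → Fin K → ℝ) : Set (Fin K → ℝ) :=
  lowerFrontier {w | ∃ πA : Strategy m n m, IsGuarantee β r πA w}

/-- The strategy that `π` prescribes from the history `h` on. -/
def continuation {m n l : ℕ} (π : Strategy m n l) (h : List (Fin m × Fin n)) :
    Strategy m n l := fun h' => π (h ++ h')

/-! ### Pareto frontiers and the dynamic programming operator -/

/-- The upset in `[0,1]^K`. -/
def upset {K : ℕ} (S : Set (Fin K → ℝ)) : Set (Fin K → ℝ) :=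
  {x ∈ Set.Icc 0 1 | ∃ y ∈ S, y ≤ x}

/-- The space of (non-empty) Pareto frontiers in `[0,1]^K` whose upset is closed and convex. -/
def frontierSpace (K : ℕ) : Set (Set (Fin K → ℝ)) :=
  {V | V.Nonempty ∧ V ⊆ Set.Icc 0 1 ∧ (∀ u ∈ V, ∀ v ∈ V, u ≤ v → u = v) ∧
    IsClosed (upset V) ∧ Convex ℝ (upset V)}

/-- The vectors of upper bounds obtained from a mixed action `α` and continuation bounds
`R a b ∈ S` that may depend on both actions. -/
def dpSet {m n K : ℕ} [NeZero n] (β : ℝ) (r : Fin m → Fin n → Fin K → ℝ)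
    (S : Set (Fin K → ℝ)) : Set (Fin K → ℝ) :=
  {u | ∃ (α : stdSimplex ℝ (Fin m)) (R : Fin m → Fin n → Fin K → ℝ), (∀ a b, R a b ∈ S) ∧
    ∀ k, u k = Finset.univ.sup' Finset.univ_nonempty
      fun b : Fin n => ∑ a, α a * (r a b k + β * R a b k)}

/-- The dynamic programming operator. -/
def dpOperator {m n K : ℕ} [NeZero n] (β : ℝ) (r : Fin m → Fin n → Fin K → ℝ)
    (V : Set (Fin K → ℝ)) : Set (Fin K → ℝ) :=
  lowerFrontier (dpSet β r V)

/-! ### Parametrization of frontiers and stationary strategies -/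

/-- The parameter set: the faces of `[0,1]^K` on which some coordinate is `0`. -/
def paramSet (K : ℕ) : Set (Fin K → ℝ) :=
  {p | (∀ k, p k ∈ Set.Icc 0 1) ∧ ∃ k, p k = 0}

/-- The `t` for which `t • 1 + p` dominates an element of `V`. -/
def feasibleShifts {K : ℕ} (p : Fin K → ℝ) (V : Set (Fin K → ℝ)) : Set ℝ :=
  {t | ∃ u ∈ V, ∀ k, u k ≤ t + p k}

/-- The smallest point of the line `t • 1 + p` that dominates an element of `V`. -/
noncomputable def paramPoint {K : ℕ} (p : Fin K → ℝ) (V : Set (Fin K → ℝ)) : Fin K → ℝ :=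
  fun k => sInf (feasibleShifts p V) + p k

/-- The bound on component `k` that results from playing the mixed action `α p` in the state `p`
and continuing with the bound of the state `q b p` when Bob plays `b`. -/
noncomputable def stateBound {m n K : ℕ} [NeZero n] (β : ℝ) (r : Fin m → Fin n → Fin K → ℝ)
    (V : Set (Fin K → ℝ)) (α : paramSet K → stdSimplex ℝ (Fin m))
    (q : Fin n → paramSet K → paramSet K) (p : paramSet K) (k : Fin K) : ℝ :=
  Finset.univ.sup' Finset.univ_nonempty fun b : Fin n =>
    ∑ a, α p a * r a b k + β * paramPoint (q b p : Fin K → ℝ) V k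

/-- The state reached from `p` after a history: each action `b` of Bob moves `p` to `q b p`. -/
def stateAfter {m n K : ℕ} (q : Fin n → paramSet K → paramSet K) (p : paramSet K)
    (h : List (Fin m × Fin n)) : paramSet K :=
  h.foldl (fun s c => q c.2 s) p

/-- The stationary strategy with initial state `p`: play the mixed action of the current state. -/
def stationary {m n K : ℕ} (α : paramSet K → stdSimplex ℝ (Fin m))
    (q : Fin n → paramSet K → paramSet K) (p : paramSet K) : Strategy m n m :=
  fun h => α (stateAfter q p h)

end VectorGame

open VectorGame

/-! Passing to upsets turns the dynamic programming operator into a monotone map on sets, whose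
greatest fixed point `G` exists by Knaster–Tarski. The closure and the convex hull of `G` are
post-fixed points, so `G` is closed and convex; since one application of the operator shrinks
uniform distances by the factor `β`, `G` is the only non-empty closed fixed point. Hence the fixed
points of the operator in the space of frontiers reduce to the lower frontier of `G`.

Bob can play any pure action first and a best response to the continuation afterwards. So the
guarantee vectors also form a post-fixed point, and they lie in `G` by coinduction. Conversely,
convexity allows Alice to replace her continuation bounds by their average over her own actions,
which yields stationary data that depend on Bob's action only. Iterating (1) for `N` stages bounds
the loss of the stationary strategy up to an error `β ^ N`; where the bound lies on the frontier,
its minimality forces equality. -/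

namespace VectorGame

variable {m n K : ℕ}

section Play

variable {X : ℕ → Type*} [∀ t, MeasurableSpace (X t)] {μ₀ : Measure (X 0)}
  {κ : (t : ℕ) → Kernel ((i : Finset.Iic t) → X i) (X (t + 1))}
  [∀ t, IsMarkovKernel (κ t)]

lemma map_eval_zero_trajMeasure :
    (Kernel.trajMeasure μ₀ κ).map (fun x => x 0) = μ₀ := by
  have hf : (fun x : (t : ℕ) → X t => x 0) =
      (fun y : (i : Finset.Iic 0) → X i => y ⟨0, by simp⟩) ∘
        Preorder.frestrictLe (π := X) 0 := rfl
  rw [hf, ← Measure.map_map (by fun_prop) (by fun_prop), Kernel.trajMeasure,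
    Measure.map_comp _ _ (by fun_prop), Kernel.traj_map_frestrictLe, Kernel.partialTraj_self,
    Measure.id_comp]
  exact (Measure.map_map (measurable_pi_apply _) (MeasurableEquiv.measurable _)).trans
    Measure.map_id

lemma integral_trajMeasure_succ [IsProbabilityMeasure μ₀] {E : Type*} [NormedAddCommGroup E]
    [NormedSpace ℝ E] {t : ℕ} {f : ((i : Finset.Iic t) → X i) → X (t + 1) → E}
    (hf : Integrable (fun y => f y.1 y.2)
      ((Kernel.trajMeasure μ₀ κ).map (Preorder.frestrictLe t) ⊗ₘ κ t)) :
    ∫ x, f (Preorder.frestrictLe t x) (x (t + 1)) ∂(Kernel.trajMeasure μ₀ κ) =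
      ∫ x, ∫ c, f (Preorder.frestrictLe t x) c ∂(κ t (Preorder.frestrictLe t x))
        ∂(Kernel.trajMeasure μ₀ κ) := by
  have hpush := Kernel.map_frestrictLe_trajMeasure_compProd_eq_map_trajMeasure
    (μ₀ := μ₀) (κ := κ) (a := t)
  have hf' := hpush ▸ hf.aestronglyMeasurable
  calc ∫ x, f (Preorder.frestrictLe t x) (x (t + 1)) ∂(Kernel.trajMeasure μ₀ κ)
      = ∫ y, f y.1 y.2 ∂((Kernel.trajMeasure μ₀ κ).map (Preorder.frestrictLe t) ⊗ₘ κ t) := by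
        rw [hpush, integral_map (by fun_prop) hf']
    _ = _ := (Measure.integral_compProd hf).trans <|
        integral_map (by fun_prop) hf.aestronglyMeasurable.integral_kernel_compProd

end Play

/-- The probability that the action pair `c` is played after the history `h`. -/
noncomputable def stageWeight (πA : Strategy m n m) (πB : Strategy m n n)
    (h : List (Fin m × Fin n)) (c : Fin m × Fin n) : ℝ :=
  πA h c.1 * πB h c.2

/-- The list of the first `t` action pairs of an infinite play. Unlike `historyOf`, it allows
`t = 0`. -/
def initialHistory (t : ℕ) (x : ℕ → Fin m × Fin n) : List (Fin m × Fin n) :=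
  List.ofFn fun i : Fin t => x i

lemma initialHistory_succ (t : ℕ) (x : ℕ → Fin m × Fin n) :
    initialHistory (t + 1) x = initialHistory t x ++ [x t] :=
  List.ofFn_succ_last

lemma mixedLaw_real_singleton {l : ℕ} (α : stdSimplex ℝ (Fin l)) (a : Fin l) :
    (mixedLaw α).real {a} = α a := by
  have h0 : 0 ≤ α a := α.2.1 a
  simp [mixedLaw, Measure.real, Measure.finsetSum_apply, Pi.single_apply, h0]

instance playLaw_isProbabilityMeasure (πA : Strategy m n m) (πB : Strategy m n n) :
    IsProbabilityMeasure (playLaw πA πB) := by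
  unfold playLaw; infer_instance

variable (πA : Strategy m n m) (πB : Strategy m n n)

lemma integral_stageLaw (h : List (Fin m × Fin n)) (f : Fin m × Fin n → ℝ) :
    ∫ c, f c ∂(stageLaw πA πB h) = ∑ c, stageWeight πA πB h c * f c := by
  rw [integral_fintype Integrable.of_finite]
  refine Finset.sum_congr rfl fun ⟨a, b⟩ _ => ?_
  rw [stageLaw, ← Set.singleton_prod_singleton, measureReal_prod_prod, mixedLaw_real_singleton,
    mixedLaw_real_singleton, smul_eq_mul, stageWeight]

lemma integrable_stage (t : ℕ) (f : Fin m × Fin n → ℝ) :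
    Integrable (fun x => f (x t)) (playLaw πA πB) :=
  .of_bound ((Measurable.of_discrete (f := f)).comp (measurable_pi_apply t)).aestronglyMeasurable
    ‖f‖ (.of_forall fun x => norm_le_pi_norm f (x t))

lemma integral_stage_zero (f : Fin m × Fin n → ℝ) :
    ∫ x, f (x 0) ∂(playLaw πA πB) = ∑ c, stageWeight πA πB [] c * f c := by
  rw [← integral_stageLaw, ← map_eval_zero_trajMeasure (X := fun _ => Fin m × Fin n)
    (μ₀ := stageLaw πA πB []) (κ := stageKernel πA πB),
    integral_map (measurable_pi_apply 0).aemeasurable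
      (by exact Measurable.of_discrete.aestronglyMeasurable), playLaw]

lemma integral_stage_condition (t : ℕ) (g : List (Fin m × Fin n) → Fin m × Fin n → ℝ) :
    ∫ x, g (initialHistory t x) (x t) ∂(playLaw πA πB) =
      ∫ x, ∑ c, stageWeight πA πB (initialHistory t x) c * g (initialHistory t x) c
        ∂(playLaw πA πB) := by
  cases t with
  | zero => simpa [initialHistory] using integral_stage_zero πA πB (g [])
  | succ t =>
    have h := integral_trajMeasure_succ (X := fun _ => Fin m × Fin n)
      (μ₀ := stageLaw πA πB []) (κ := stageKernel πA πB) (t := t)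
      (f := fun y c => g (historyOf t y) c) Integrable.of_finite
    simp_rw [← integral_stageLaw]
    exact h

lemma integral_initialHistory_succ (t : ℕ) (g : List (Fin m × Fin n) → ℝ) :
    ∫ x, g (initialHistory (t + 1) x) ∂(playLaw πA πB) =
      ∑ c, stageWeight πA πB [] c * ∫ x, g (c :: initialHistory t x)
        ∂(playLaw (continuation πA [c]) (continuation πB [c])) := by
  induction t generalizing g with
  | zero => simpa [initialHistory] using integral_stage_zero πA πB fun c => g [c]
  | succ t ih =>
    have hlast := integral_stage_condition πA πB (t + 1) fun h c => g (h ++ [c])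
    have hlast' := fun c => integral_stage_condition (continuation πA [c]) (continuation πB [c]) t
      fun h c' => g (c :: (h ++ [c']))
    simp_rw [← initialHistory_succ] at hlast hlast'
    rw [hlast, ih fun h => ∑ c, stageWeight πA πB h c * g (h ++ [c])]
    exact Finset.sum_congr rfl fun c _ => congrArg _ (hlast' c).symm

lemma integral_stage_succ (t : ℕ) (f : Fin m × Fin n → ℝ) :
    ∫ x, f (x (t + 1)) ∂(playLaw πA πB) =
      ∑ c, stageWeight πA πB [] c *
        ∫ x, f (x t) ∂(playLaw (continuation πA [c]) (continuation πB [c])) := by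
  rw [integral_stage_condition πA πB (t + 1) fun _ c => f c,
    integral_initialHistory_succ πA πB t fun h => ∑ c, stageWeight πA πB h c * f c]
  exact Finset.sum_congr rfl fun c _ => congrArg _
    (integral_stage_condition (continuation πA [c]) (continuation πB [c]) t fun _ c => f c).symm

lemma continuous_integral_stage (f : Fin m × Fin n → ℝ) (t : ℕ) :
    Continuous fun πB : Strategy m n n => ∫ x, f (x t) ∂(playLaw πA πB) := by
  have hweight (πA : Strategy m n m) (c : Fin m × Fin n) :
      Continuous fun πB : Strategy m n n => stageWeight πA πB [] c :=
    continuous_const.mul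
      ((continuous_apply c.2).comp (continuous_subtype_val.comp (continuous_apply [])))
  induction t generalizing πA with
  | zero =>
    simp_rw [integral_stage_zero]
    exact continuous_finsetSum _ fun c _ => (hweight πA c).mul continuous_const
  | succ t ih =>
    simp_rw [integral_stage_succ]
    have hcont (c : Fin m × Fin n) :
        Continuous fun πB : Strategy m n n => continuation πB [c] :=
      continuous_pi fun h => continuous_apply _
    exact continuous_finsetSum _ fun c _ => (hweight πA c).mul ((ih _).comp (hcont c))

section Discounting

variable {β : ℝ} {πA πB}

lemma abs_lt_one_of_mem_Ico (hβ : β ∈ Set.Ico (0 : ℝ) 1) : |β| < 1 := by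
  rw [abs_of_nonneg hβ.1]
  exact hβ.2

lemma tendsto_add_pow_smul {E : Type*} [AddCommGroup E] [TopologicalSpace E] [Module ℝ E]
    [ContinuousAdd E] [ContinuousSMul ℝ E] (hβ : |β| < 1) (x c : E) :
    Filter.Tendsto (fun N : ℕ => x + β ^ N • c) Filter.atTop (nhds x) := by
  simpa using ((tendsto_pow_atTop_nhds_zero_of_abs_lt_one hβ).smul_const c).const_add x

lemma summable_abs_pow_mul (hβ : |β| < 1) (C : ℝ) : Summable fun t : ℕ => |β| ^ t * C :=
  (summable_geometric_of_lt_one (abs_nonneg β) hβ).mul_right C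

variable {r : Fin m → Fin n → Fin K → ℝ}

lemma norm_pow_mul_le {y C : ℝ} (hy : ‖y‖ ≤ C) (t : ℕ) : ‖β ^ t * y‖ ≤ |β| ^ t * C := by
  rw [norm_mul, norm_pow, Real.norm_eq_abs β]
  gcongr

theorem hasSum_expectedLoss (hβ : |β| < 1) (r : Fin m → Fin n → Fin K → ℝ)
    (πA : Strategy m n m) (πB : Strategy m n n) (k : Fin K) :
    HasSum (fun t : ℕ => β ^ t * ∫ x, r (x t).1 (x t).2 k ∂(playLaw πA πB))
      (expectedLoss β r πA πB k) := by
  let f : Fin m × Fin n → ℝ := fun c => r c.1 c.2 k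
  have hbound (t : ℕ) (x : ℕ → Fin m × Fin n) : ‖β ^ t * f (x t)‖ ≤ |β| ^ t * ‖f‖ :=
    norm_pow_mul_le (norm_le_pi_norm f (x t)) t
  have hmeas (t : ℕ) : Measurable fun x : ℕ → Fin m × Fin n => β ^ t * f (x t) :=
    measurable_const.mul ((Measurable.of_discrete (f := f)).comp (measurable_pi_apply t))
  have hsum := summable_abs_pow_mul hβ ‖f‖
  simp_rw [← integral_const_mul]
  exact hasSum_integral_of_dominated_convergence (fun t _ => |β| ^ t * ‖f‖)
    (fun t => (hmeas t).aestronglyMeasurable)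
    (fun t => .of_forall (hbound t)) (.of_forall fun _ => hsum) (integrable_const _)
    (.of_forall fun x => (Summable.of_norm_bounded hsum fun t => hbound t x).hasSum)

theorem expectedLoss_eq_sum (hβ : |β| < 1) (r : Fin m → Fin n → Fin K → ℝ)
    (πA : Strategy m n m) (πB : Strategy m n n) (k : Fin K) :
    expectedLoss β r πA πB k = ∑ c, stageWeight πA πB [] c *
      (r c.1 c.2 k + β * expectedLoss β r (continuation πA [c]) (continuation πB [c]) k) := by
  have htail : HasSum
      (fun t : ℕ => β ^ (t + 1) * ∫ x, r (x (t + 1)).1 (x (t + 1)).2 k ∂(playLaw πA πB))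
      (∑ c, stageWeight πA πB [] c *
        (β * expectedLoss β r (continuation πA [c]) (continuation πB [c]) k)) := by
    convert! hasSum_sum fun c (_ : c ∈ Finset.univ) =>
      ((hasSum_expectedLoss hβ r (continuation πA [c]) (continuation πB [c]) k).mul_left
        β).mul_left (stageWeight πA πB [] c) using 2 with t
    rw [integral_stage_succ πA πB t fun c => r c.1 c.2 k, Finset.mul_sum]
    exact Finset.sum_congr rfl fun c _ => by ring
  have h := (hasSum_nat_add_iff' 1).2 (hasSum_expectedLoss hβ r πA πB k)
  have hhead := integral_stage_zero πA πB fun c => r c.1 c.2 k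
  rw [Finset.sum_range_one, pow_zero, one_mul, hhead] at h
  simp_rw [mul_add, Finset.sum_add_distrib]
  linarith [h.unique htail]

theorem continuous_expectedLoss (hβ : |β| < 1) (r : Fin m → Fin n → Fin K → ℝ)
    (πA : Strategy m n m) (k : Fin K) :
    Continuous fun πB : Strategy m n n => expectedLoss β r πA πB k := by
  let f : Fin m × Fin n → ℝ := fun c => r c.1 c.2 k
  have hbound (πB : Strategy m n n) (t : ℕ) : ‖∫ x, f (x t) ∂(playLaw πA πB)‖ ≤ ‖f‖ := by
    simpa using norm_integral_le_of_norm_le_const (μ := playLaw πA πB)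
      (.of_forall fun x => norm_le_pi_norm f (x t))
  simp_rw [← fun πB => (hasSum_expectedLoss hβ r πA πB k).tsum_eq]
  exact continuous_tsum (fun t => (continuous_integral_stage πA f t).const_mul _)
    (summable_abs_pow_mul hβ ‖f‖) fun t πB => norm_pow_mul_le (hbound πB t) t

theorem exists_isGuarantee [NeZero n] (hβ : |β| < 1) (r : Fin m → Fin n → Fin K → ℝ)
    (πA : Strategy m n m) : ∃ w, IsGuarantee β r πA w := by
  have : Nonempty (Strategy m n n) := ⟨fun _ => stdSimplex.vertex 0⟩
  choose w hw using fun k =>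
    (isCompact_range (continuous_expectedLoss hβ r πA k)).exists_isGreatest (Set.range_nonempty _)
  exact ⟨w, hw⟩

theorem expectedLoss_mem_Icc (hβ : β ∈ Set.Ico (0 : ℝ) 1)
    (hr : ∀ a b k, r a b k ∈ Set.Icc 0 (1 - β)) (πA : Strategy m n m) (πB : Strategy m n n) :
    expectedLoss β r πA πB ∈ Set.Icc (0 : Fin K → ℝ) 1 := by
  have hgeom : HasSum (fun t : ℕ => β ^ t * (1 - β)) 1 := by
    simpa [inv_mul_cancel₀ (sub_pos.2 hβ.2).ne'] using
      (hasSum_geometric_of_lt_one hβ.1 hβ.2).mul_right (1 - β)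
  have hstage (t : ℕ) (k : Fin K) :
      ∫ x, r (x t).1 (x t).2 k ∂(playLaw πA πB) ∈ Set.Icc 0 (1 - β) :=
    (convex_Icc _ _).integral_mem isClosed_Icc (.of_forall fun x => hr _ _ k)
      (integrable_stage πA πB t fun c => r c.1 c.2 k)
  exact ⟨fun k => (hasSum_expectedLoss (abs_lt_one_of_mem_Ico hβ) r πA πB k).nonneg fun t =>
      mul_nonneg (pow_nonneg hβ.1 t) (hstage t k).1,
    fun k => hasSum_le (fun t => mul_le_mul_of_nonneg_left (hstage t k).2 (pow_nonneg hβ.1 t))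
      (hasSum_expectedLoss (abs_lt_one_of_mem_Ico hβ) r πA πB k) hgeom⟩

end Discounting

section Frontiers

variable {S T V : Set (Fin K → ℝ)}

lemma upset_subset_Icc : upset S ⊆ Set.Icc 0 1 := fun _ hx => hx.1

lemma subset_upset (hS : S ⊆ Set.Icc 0 1) : S ⊆ upset S := fun x hx => ⟨hS hx, x, hx, le_rfl⟩

lemma upset_mono (h : S ⊆ T) : upset S ⊆ upset T :=
  fun _ ⟨hx, y, hy, hyx⟩ => ⟨hx, y, h hy, hyx⟩

lemma upset_upset (S : Set (Fin K → ℝ)) : upset (upset S) = upset S := by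
  refine subset_antisymm ?_ (subset_upset upset_subset_Icc)
  rintro x ⟨hx, y, ⟨-, z, hz, hzy⟩, hyx⟩
  exact ⟨hx, z, hz, hzy.trans hyx⟩

lemma isCompact_upset (hS : IsClosed (upset S)) : IsCompact (upset S) :=
  isCompact_Icc.of_isClosed_subset hS upset_subset_Icc

lemma isClosed_upset_of_isCompact (hS : IsCompact S) : IsClosed (upset S) := by
  have h : upset S = Set.Icc 0 1 ∩ upperClosure S := rfl
  rw [h]
  exact isClosed_Icc.inter (hS.isClosed.upperClosure_pi hS.isBounded.bddBelow)

lemma exists_mem_lowerFrontier_le (hS : IsCompact S) {x : Fin K → ℝ} (hx : x ∈ S) :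
    ∃ y ∈ lowerFrontier S, y ≤ x := by
  have hcont : Continuous fun z : Fin K → ℝ => ∑ k, z k := by fun_prop
  obtain ⟨y, ⟨hyS, hyx⟩, hmin⟩ := (hS.inter_right isClosed_Iic).exists_isMinOn
    ⟨x, hx, le_refl x⟩ hcont.continuousOn
  refine ⟨y, ⟨hyS, fun z hz hzy => by_contra fun hne => ?_⟩, hyx⟩
  obtain ⟨hle, k, hk⟩ := Pi.lt_def.1 (lt_of_le_of_ne hzy hne)
  exact (Finset.sum_lt_sum (fun i _ => hle i) ⟨k, Finset.mem_univ k, hk⟩).not_ge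
    (hmin ⟨hz, hzy.trans hyx⟩)

lemma upset_lowerFrontier (hS : IsCompact S) : upset (lowerFrontier S) = upset S := by
  refine subset_antisymm (upset_mono fun _ hx => hx.1) ?_
  rintro x ⟨hx, y, hy, hyx⟩
  obtain ⟨z, hz, hzy⟩ := exists_mem_lowerFrontier_le hS hy
  exact ⟨hx, z, hz, hzy.trans hyx⟩

lemma lowerFrontier_eq_of_subset (hST : S ⊆ T) (h : ∀ x ∈ T, ∃ y ∈ S, y ≤ x) :
    lowerFrontier S = lowerFrontier T := by
  ext x
  constructor
  · rintro ⟨hxS, hmin⟩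
    refine ⟨hST hxS, fun y hy hyx => ?_⟩
    obtain ⟨z, hz, hzy⟩ := h y hy
    exact hyx.antisymm (hmin z hz (hzy.trans hyx) ▸ hzy)
  · rintro ⟨hxT, hmin⟩
    obtain ⟨z, hz, hzx⟩ := h x hxT
    exact ⟨hmin z (hST hz) hzx ▸ hz, fun y hy => hmin y (hST hy)⟩

lemma lowerFrontier_upset (hS : S ⊆ Set.Icc 0 1) :
    lowerFrontier (upset S) = lowerFrontier S :=
  (lowerFrontier_eq_of_subset (subset_upset hS) fun _ hx => hx.2).symm

lemma lowerFrontier_eq_self (hV : ∀ u ∈ V, ∀ v ∈ V, u ≤ v → u = v) : lowerFrontier V = V :=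
  subset_antisymm (fun _ hx => hx.1) fun v hv => ⟨hv, fun u hu => hV u hu v hv⟩

lemma lowerFrontier_mem_frontierSpace (hne : S.Nonempty) (hS : IsCompact S)
    (hsub : S ⊆ Set.Icc 0 1) (hconv : Convex ℝ (upset S)) :
    lowerFrontier S ∈ frontierSpace K := by
  obtain ⟨x, hx⟩ := hne
  obtain ⟨y, hy, -⟩ := exists_mem_lowerFrontier_le hS hx
  refine ⟨⟨y, hy⟩, fun z hz => hsub hz.1, fun u hu v hv huv => hv.2 u hu.1 huv, ?_⟩
  rw [upset_lowerFrontier hS]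
  exact ⟨isClosed_upset_of_isCompact hS, hconv⟩

end Frontiers

section StageLoss

/-- The vector of expected losses of Alice when she plays the mixed action `α`, Bob plays `b`, and
the continuation after the action pair `(a, b)` costs `R a b`. -/
def stageLoss (β : ℝ) (r : Fin m → Fin n → Fin K → ℝ) (α : stdSimplex ℝ (Fin m))
    (R : Fin m → Fin n → Fin K → ℝ) (b : Fin n) : Fin K → ℝ :=
  fun k => ∑ a, α a * (r a b k + β * R a b k)

variable {β : ℝ} {r R R' : Fin m → Fin n → Fin K → ℝ} {α : stdSimplex ℝ (Fin m)} {b : Fin n}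
  {S T : Set (Fin K → ℝ)}

lemma stageLoss_add_const (c : Fin K → ℝ) :
    stageLoss β r α (fun a b => R a b + c) b = stageLoss β r α R b + β • c := by
  ext k
  have hα : ∑ a, α a = 1 := α.2.2
  simp only [stageLoss, Pi.add_apply, Pi.smul_apply, smul_eq_mul]
  rw [← one_mul (β * c k), ← hα, Finset.sum_mul, ← Finset.sum_add_distrib]
  exact Finset.sum_congr rfl fun a _ => by ring

lemma stageLoss_const (Q : Fin n → Fin K → ℝ) (k : Fin K) :
    stageLoss β r α (fun _ b => Q b) b k = ∑ a, α a * r a b k + β * Q b k := by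
  have hα : ∑ a, α a = 1 := α.2.2
  simp only [stageLoss, mul_add, Finset.sum_add_distrib, ← Finset.sum_mul, hα, one_mul]

lemma stageLoss_average :
    stageLoss β r α (fun _ b => ∑ a, α a • R a b) b = stageLoss β r α R b := by
  ext k
  rw [stageLoss_const fun b => ∑ a, α a • R a b]
  simp only [stageLoss, mul_add, Finset.sum_add_distrib, Finset.sum_apply, Pi.smul_apply,
    smul_eq_mul, Finset.mul_sum, mul_left_comm β]

lemma stageLoss_mono (hβ : 0 ≤ β) (h : ∀ a, R a b ≤ R' a b) :
    stageLoss β r α R b ≤ stageLoss β r α R' b := fun k =>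
  Finset.sum_le_sum fun a _ => mul_le_mul_of_nonneg_left
    (add_le_add_right (mul_le_mul_of_nonneg_left (h a k) hβ) _) (α.2.1 a)

lemma stageLoss_mem_Icc (hβ : 0 ≤ β) (hr : ∀ a b k, r a b k ∈ Set.Icc 0 (1 - β))
    (hR : ∀ a, R a b ∈ Set.Icc 0 1) : stageLoss β r α R b ∈ Set.Icc 0 1 := by
  have hsummand (a : Fin m) (k : Fin K) : r a b k + β * R a b k ∈ Set.Icc (0 : ℝ) 1 :=
    ⟨add_nonneg (hr a b k).1 (mul_nonneg hβ ((hR a).1 k)),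
      by linarith [(hr a b k).2, mul_le_of_le_one_right hβ ((hR a).2 k)]⟩
  have h (k : Fin K) : stageLoss β r α R b k ∈ Set.Icc (0 : ℝ) 1 :=
    (convex_Icc (0 : ℝ) 1).sum_mem (fun a _ => α.2.1 a) α.2.2 fun a _ => hsummand a k
  exact ⟨fun k => (h k).1, fun k => (h k).2⟩

lemma mem_dpSet [NeZero n] {u : Fin K → ℝ} :
    u ∈ dpSet β r S ↔ ∃ (α : stdSimplex ℝ (Fin m)) (R : Fin m → Fin n → Fin K → ℝ),
      (∀ a b, R a b ∈ S) ∧ u = Finset.univ.sup' Finset.univ_nonempty (stageLoss β r α R) := by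
  simp only [dpSet, stageLoss, funext_iff, Finset.sup'_apply, Set.mem_ofPred]

lemma mem_upset_dpSet [NeZero n] {x : Fin K → ℝ} :
    x ∈ upset (dpSet β r S) ↔ x ∈ Set.Icc 0 1 ∧
      ∃ (α : stdSimplex ℝ (Fin m)) (R : Fin m → Fin n → Fin K → ℝ),
        (∀ a b, R a b ∈ S) ∧ ∀ b, stageLoss β r α R b ≤ x := by
  refine and_congr_right fun _ => ⟨?_, ?_⟩
  · rintro ⟨u, hu, hux⟩
    obtain ⟨α, R, hR, rfl⟩ := mem_dpSet.1 hu
    exact ⟨α, R, hR, fun b => (Finset.le_sup' _ (Finset.mem_univ b)).trans hux⟩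
  · rintro ⟨α, R, hR, hx⟩
    exact ⟨_, mem_dpSet.2 ⟨α, R, hR, rfl⟩, Finset.sup'_le _ _ fun b _ => hx b⟩

lemma dpSet_mono [NeZero n] (h : S ⊆ T) : dpSet β r S ⊆ dpSet β r T :=
  fun _ ⟨α, R, hR, hu⟩ => ⟨α, R, fun a b => h (hR a b), hu⟩

lemma dpSet_subset_Icc [NeZero n] (hβ : 0 ≤ β) (hr : ∀ a b k, r a b k ∈ Set.Icc 0 (1 - β))
    (hS : S ⊆ Set.Icc 0 1) : dpSet β r S ⊆ Set.Icc 0 1 := by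
  intro u hu
  obtain ⟨α, R, hR, rfl⟩ := mem_dpSet.1 hu
  have h (b : Fin n) : stageLoss β r α R b ∈ Set.Icc 0 1 :=
    stageLoss_mem_Icc hβ hr fun a => hS (hR a b)
  exact ⟨(h 0).1.trans (Finset.le_sup' _ (Finset.mem_univ 0)),
    Finset.sup'_le _ _ fun b _ => (h b).2⟩

lemma isCompact_dpSet [NeZero n] (hS : IsCompact S) : IsCompact (dpSet β r S) := by
  let f (z : stdSimplex ℝ (Fin m) × (Fin m → Fin n → Fin K → ℝ)) : Fin K → ℝ :=
    Finset.univ.sup' Finset.univ_nonempty (stageLoss β r z.1 z.2)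
  have hα (a : Fin m) : Continuous fun α : stdSimplex ℝ (Fin m) => α a :=
    (continuous_apply a).comp continuous_subtype_val
  have hf : Continuous f := by
    refine continuous_pi fun k => ?_
    simp only [f, Finset.sup'_apply]
    exact Continuous.finset_sup'_apply _ fun b _ => continuous_finsetSum _ fun a _ =>
      ((hα a).comp continuous_fst).mul (by fun_prop)
  have himage : dpSet β r S = f '' Set.univ ×ˢ Set.univ.pi fun _ => Set.univ.pi fun _ => S := by
    ext u
    rw [mem_dpSet]
    simp [f, Set.mem_image, eq_comm]
  rw [himage]
  exact (isCompact_univ.prod (isCompact_univ_pi fun _ => isCompact_univ_pi fun _ => hS)).image hf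

lemma convex_upset_dpSet [NeZero n] (hS : Convex ℝ S) : Convex ℝ (upset (dpSet β r S)) := by
  intro x hx y hy s t hs ht hst
  obtain ⟨hx, α, R, hR, hRx⟩ := mem_upset_dpSet.1 hx
  obtain ⟨hy, α', R', hR', hRy⟩ := mem_upset_dpSet.1 hy
  choose Z hZ hZeq using fun a b => hS.exists_mem_add_smul_eq (hR a b) (hR' a b)
    (mul_nonneg hs (α.2.1 a)) (mul_nonneg ht (α'.2.1 a))
  refine mem_upset_dpSet.2 ⟨convex_Icc _ _ hx hy hs ht hst, ⟨s • (α : Fin m → ℝ) + t • α',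
    convex_stdSimplex ℝ (Fin m) α.2 α'.2 hs ht hst⟩, Z, hZ, fun b k => ?_⟩
  have hZk (a : Fin m) : (s * α a + t * α' a) * Z a b k =
      s * α a * R a b k + t * α' a * R' a b k := congrFun (hZeq a b) k
  calc ∑ a, (s * α a + t * α' a) * (r a b k + β * Z a b k)
      = s * stageLoss β r α R b k + t * stageLoss β r α' R' b k := by
        rw [stageLoss, stageLoss, Finset.mul_sum, Finset.mul_sum, ← Finset.sum_add_distrib]
        exact Finset.sum_congr rfl fun a _ => by linear_combination β * hZk a
    _ ≤ s * x k + t * y k := add_le_add (mul_le_mul_of_nonneg_left (hRx b k) hs)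
        (mul_le_mul_of_nonneg_left (hRy b k) ht)

end StageLoss

section FixedPoint

variable [NeZero n] {β : ℝ} {r : Fin m → Fin n → Fin K → ℝ} {S T U V : Set (Fin K → ℝ)}

lemma exists_mem_dpSet_le_add (hβ : 0 ≤ β) {c : Fin K → ℝ} (h : ∀ x ∈ S, ∃ y ∈ T, y ≤ x + c) :
    ∀ x ∈ dpSet β r S, ∃ y ∈ dpSet β r T, y ≤ x + β • c := by
  intro x hx
  obtain ⟨α, R, hR, rfl⟩ := mem_dpSet.1 hx
  choose Q hQ hQR using fun a b => h (R a b) (hR a b)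
  refine ⟨_, mem_dpSet.2 ⟨α, Q, hQ, rfl⟩, Finset.sup'_le _ _ fun b _ => ?_⟩
  calc stageLoss β r α Q b
      ≤ stageLoss β r α (fun a b => R a b + c) b := stageLoss_mono hβ fun a => hQR a b
    _ = stageLoss β r α R b + β • c := stageLoss_add_const c
    _ ≤ _ := by gcongr; exact Finset.le_sup' _ (Finset.mem_univ b)

lemma upset_dpSet_upset (hβ : 0 ≤ β) (hV : V ⊆ Set.Icc 0 1) :
    upset (dpSet β r (upset V)) = upset (dpSet β r V) := by
  refine subset_antisymm ?_ (upset_mono (dpSet_mono (subset_upset hV)))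
  rintro x ⟨hx, u, hu, hux⟩
  obtain ⟨y, hy, hyu⟩ := exists_mem_dpSet_le_add (T := V) (c := 0) hβ
    (by simpa using fun z (hz : z ∈ upset V) => hz.2) u hu
  exact ⟨hx, y, hy, by simpa using hyu.trans (add_le_add_left hux _)⟩

/-- The dynamic programming operator on upsets, as a monotone map. Its fixed points correspond to
those of `dpOperator` under `V ↦ upset V`. -/
def dpUpset (β : ℝ) (r : Fin m → Fin n → Fin K → ℝ) :
    Set (Fin K → ℝ) →o Set (Fin K → ℝ) where
  toFun S := upset (dpSet β r S)
  monotone' _ _ h := upset_mono (dpSet_mono h)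

/-- The greatest fixed point of the dynamic programming operator on upsets. -/
def greatestUpset (β : ℝ) (r : Fin m → Fin n → Fin K → ℝ) : Set (Fin K → ℝ) :=
  (dpUpset β r).gfp

lemma dpUpset_greatestUpset : dpUpset β r (greatestUpset β r) = greatestUpset β r :=
  (dpUpset β r).map_gfp

lemma subset_greatestUpset (hU : U ⊆ dpUpset β r U) : U ⊆ greatestUpset β r :=
  (dpUpset β r).le_gfp hU

lemma greatestUpset_subset_dpUpset (hU : greatestUpset β r ⊆ U) :
    greatestUpset β r ⊆ dpUpset β r U :=
  dpUpset_greatestUpset.ge.trans ((dpUpset β r).mono hU)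

lemma greatestUpset_subset_Icc : greatestUpset β r ⊆ Set.Icc 0 1 :=
  dpUpset_greatestUpset.ge.trans upset_subset_Icc

lemma upset_greatestUpset : upset (greatestUpset β r) = greatestUpset β r := by
  rw [← dpUpset_greatestUpset]
  exact upset_upset _

lemma isClosed_dpUpset (hS : IsCompact S) : IsClosed (dpUpset β r S) :=
  isClosed_upset_of_isCompact (isCompact_dpSet hS)

lemma isCompact_greatestUpset : IsCompact (greatestUpset β r) := by
  have hcompact : IsCompact (closure (greatestUpset β r)) :=
    isCompact_Icc.of_isClosed_subset isClosed_closure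
      (closure_minimal greatestUpset_subset_Icc isClosed_Icc)
  have hclosure : closure (greatestUpset β r) ⊆ greatestUpset β r :=
    subset_greatestUpset
      (closure_minimal (greatestUpset_subset_dpUpset subset_closure) (isClosed_dpUpset hcompact))
  rwa [hclosure.antisymm subset_closure] at hcompact

lemma convex_greatestUpset : Convex ℝ (greatestUpset β r) := by
  have hhull : convexHull ℝ (greatestUpset β r) ⊆ greatestUpset β r :=
    subset_greatestUpset (convexHull_min (greatestUpset_subset_dpUpset (subset_convexHull ℝ _))
      (convex_upset_dpSet (convex_convexHull ℝ _)))
  rw [← hhull.antisymm (subset_convexHull ℝ _)]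
  exact convex_convexHull ℝ _

lemma greatestUpset_nonempty [NeZero m] (hβ : 0 ≤ β)
    (hr : ∀ a b k, r a b k ∈ Set.Icc 0 (1 - β)) : (greatestUpset β r).Nonempty := by
  have h1 : (1 : Fin K → ℝ) ∈ Set.Icc 0 1 := ⟨zero_le_one, le_rfl⟩
  refine ⟨1, subset_greatestUpset (U := {1}) (Set.singleton_subset_iff.2 ?_) rfl⟩
  exact mem_upset_dpSet.2 ⟨h1, stdSimplex.vertex 0, fun _ _ => 1, fun _ _ => rfl,
    fun b => (stageLoss_mem_Icc hβ hr fun _ => h1).2⟩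

-- One application of the operator multiplies the uniform distance between two fixed points by `β`.
lemma exists_le_add_pow_of_dpUpset_eq_self (hβ : 0 ≤ β)
    (hr : ∀ a b k, r a b k ∈ Set.Icc 0 (1 - β)) (hS : dpUpset β r S = S)
    (hT : dpUpset β r T = T) (hne : T.Nonempty) (N : ℕ) :
    ∀ x ∈ S, ∃ y ∈ T, y ≤ x + β ^ N • 1 := by
  have hSsub : S ⊆ Set.Icc 0 1 := hS ▸ upset_subset_Icc
  have hTsub : T ⊆ Set.Icc 0 1 := hT ▸ upset_subset_Icc
  induction N with
  | zero =>
    intro x hx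
    obtain ⟨y, hy⟩ := hne
    exact ⟨y, hy, by simpa using (hTsub hy).2.trans (le_add_of_nonneg_left (hSsub hx).1)⟩
  | succ N ih =>
    intro x hx
    obtain ⟨-, u, hu, hux⟩ : x ∈ upset (dpSet β r S) := hS.ge hx
    obtain ⟨y, hy, hyu⟩ := exists_mem_dpSet_le_add hβ ih u hu
    refine ⟨y, hT.le (subset_upset (dpSet_subset_Icc hβ hr hTsub) hy), ?_⟩
    rw [pow_succ', mul_smul]
    exact hyu.trans (add_le_add_left hux _)

theorem eq_greatestUpset (hβ : β ∈ Set.Ico (0 : ℝ) 1)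
    (hr : ∀ a b k, r a b k ∈ Set.Icc 0 (1 - β)) (hU : dpUpset β r U = U) (hne : U.Nonempty)
    (hc : IsClosed U) : U = greatestUpset β r := by
  refine (subset_greatestUpset hU.ge).antisymm fun x hx => ?_
  choose y hyU hyx using fun N =>
    exists_le_add_pow_of_dpUpset_eq_self hβ.1 hr dpUpset_greatestUpset hU hne N x hx
  have hmem (N : ℕ) : x ⊔ y N ∈ U := by
    have hUsub : U ⊆ Set.Icc 0 1 := hU ▸ upset_subset_Icc
    have hx1 := greatestUpset_subset_Icc hx
    obtain ⟨-, u, hu, huy⟩ : y N ∈ upset (dpSet β r U) := hU.ge (hyU N)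
    exact hU.le ⟨⟨hx1.1.trans le_sup_left, sup_le hx1.2 (hUsub (hyU N)).2⟩, u, hu,
      huy.trans le_sup_right⟩
  have hle (N : ℕ) : x ⊔ y N ≤ x + β ^ N • 1 :=
    sup_le (le_add_of_nonneg_right (smul_nonneg (pow_nonneg hβ.1 N) zero_le_one)) (hyx N)
  have hlim := tendsto_add_pow_smul (abs_lt_one_of_mem_Ico hβ) x 1
  exact hc.mem_of_tendsto (tendsto_pi_nhds.2 fun k =>
    tendsto_of_tendsto_of_tendsto_of_le_of_le tendsto_const_nhds (tendsto_pi_nhds.1 hlim k)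
      (fun N => le_sup_left) fun N => hle N k) (.of_forall hmem)

lemma dpOperator_eq_lowerFrontier_dpUpset (hβ : 0 ≤ β)
    (hr : ∀ a b k, r a b k ∈ Set.Icc 0 (1 - β)) (hV : V ⊆ Set.Icc 0 1) :
    dpOperator β r V = lowerFrontier (dpUpset β r (upset V)) := by
  change _ = lowerFrontier (upset (dpSet β r (upset V)))
  rw [upset_dpSet_upset hβ hV, lowerFrontier_upset (dpSet_subset_Icc hβ hr hV), dpOperator]

theorem dpOperator_eq_self_iff (hβ : β ∈ Set.Ico (0 : ℝ) 1)
    (hr : ∀ a b k, r a b k ∈ Set.Icc 0 (1 - β)) (hV : V ∈ frontierSpace K) :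
    dpOperator β r V = V ↔ upset V = greatestUpset β r := by
  obtain ⟨hne, hcube, hanti, hclosed, -⟩ := hV
  have hdp := dpOperator_eq_lowerFrontier_dpUpset hβ.1 hr hcube
  constructor
  · intro hfix
    refine eq_greatestUpset hβ hr ?_ (hne.mono (subset_upset hcube)) hclosed
    have hcompact : IsCompact (dpUpset β r (upset V)) :=
      isCompact_upset (isClosed_dpUpset (isCompact_upset hclosed))
    have h := upset_lowerFrontier hcompact
    rw [← hdp, hfix] at h
    exact (h.trans (upset_upset _)).symm
  · intro h
    rw [hdp, h, dpUpset_greatestUpset, ← h, lowerFrontier_upset hcube, lowerFrontier_eq_self hanti]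

theorem existsUnique_fixedPoint [NeZero m] (hβ : β ∈ Set.Ico (0 : ℝ) 1)
    (hr : ∀ a b k, r a b k ∈ Set.Icc 0 (1 - β)) :
    ∃! V : Set (Fin K → ℝ), V ∈ frontierSpace K ∧ dpOperator β r V = V := by
  have hmem : lowerFrontier (greatestUpset β r) ∈ frontierSpace K :=
    lowerFrontier_mem_frontierSpace (greatestUpset_nonempty hβ.1 hr) isCompact_greatestUpset
      greatestUpset_subset_Icc (by rw [upset_greatestUpset]; exact convex_greatestUpset)
  refine ⟨lowerFrontier (greatestUpset β r), ⟨hmem, (dpOperator_eq_self_iff hβ hr hmem).2 ?_⟩, ?_⟩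
  · rw [upset_lowerFrontier isCompact_greatestUpset, upset_greatestUpset]
  · rintro V ⟨hV, hfix⟩
    rw [← (dpOperator_eq_self_iff hβ hr hV).1 hfix, lowerFrontier_upset hV.2.1,
      lowerFrontier_eq_self hV.2.2.1]

end FixedPoint

section RepeatedGame

variable {β : ℝ} {r : Fin m → Fin n → Fin K → ℝ} {πA : Strategy m n m} {πB : Strategy m n n}

lemma expectedLoss_eq_sum_stageLoss (hβ : |β| < 1) :
    expectedLoss β r πA πB = ∑ b, πB [] b • stageLoss β r (πA [])
      (fun a b => expectedLoss β r (continuation πA [(a, b)]) (continuation πB [(a, b)])) b := by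
  ext k
  rw [expectedLoss_eq_sum hβ, Fintype.sum_prod_type_right]
  simp only [stageLoss, Finset.sum_apply, Pi.smul_apply, smul_eq_mul, Finset.mul_sum]
  exact Finset.sum_congr rfl fun b _ => Finset.sum_congr rfl fun a _ => by
    rw [stageWeight]; ring

lemma expectedLoss_le_of_continuation (hβ : β ∈ Set.Ico (0 : ℝ) 1)
    {v : Fin m → Fin n → Fin K → ℝ} {w : Fin K → ℝ}
    (hv : ∀ a b, expectedLoss β r (continuation πA [(a, b)]) (continuation πB [(a, b)]) ≤ v a b)
    (hw : ∀ b, stageLoss β r (πA []) v b ≤ w) : expectedLoss β r πA πB ≤ w := by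
  rw [expectedLoss_eq_sum_stageLoss (abs_lt_one_of_mem_Ico hβ)]
  exact (convex_Iic w).sum_mem (fun b _ => (πB []).2.1 b) (πB []).2.2 fun b _ =>
    (stageLoss_mono hβ.1 fun a => hv a b).trans (hw b)

theorem expectedLoss_le_of_stageLoss_le (hβ : β ∈ Set.Ico (0 : ℝ) 1)
    (hr : ∀ a b k, r a b k ∈ Set.Icc 0 (1 - β)) {S : Type*} {σ : S → Strategy m n m}
    {next : S → Fin m × Fin n → S} (hσ : ∀ s c, continuation (σ s) [c] = σ (next s c))
    {v : S → Fin K → ℝ} (hv : ∀ s, 0 ≤ v s)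
    (hstage : ∀ s b, stageLoss β r (σ s []) (fun a b => v (next s (a, b))) b ≤ v s)
    (s : S) (πB : Strategy m n n) : expectedLoss β r (σ s) πB ≤ v s := by
  have happrox (N : ℕ) : ∀ s πB, expectedLoss β r (σ s) πB ≤ v s + β ^ N • 1 := by
    induction N with
    | zero =>
      intro s πB
      simpa using (expectedLoss_mem_Icc hβ hr (σ s) πB).2.trans (le_add_of_nonneg_left (hv s))
    | succ N ih =>
      intro s πB
      refine expectedLoss_le_of_continuation hβ (v := fun a b => v (next s (a, b)) + β ^ N • 1)
        (fun a b => hσ s (a, b) ▸ ih _ _) fun b => ?_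
      rw [stageLoss_add_const (R := fun a b => v (next s (a, b))), smul_smul, ← pow_succ']
      exact add_le_add_left (hstage s b) _
  exact ge_of_tendsto' (tendsto_add_pow_smul (abs_lt_one_of_mem_Ico hβ) (v s) 1)
    fun N => happrox N s πB

/-- The strategy of Bob that plays `b` in the first stage and follows `σ c` once the first action
pair is `c`. With `σ` a family of best responses, it lets Bob attain the one-stage bounds. -/
noncomputable def pureThen (b : Fin n) (σ : Fin m × Fin n → Strategy m n n) : Strategy m n n
  | [] => stdSimplex.vertex b
  | c :: h => σ c h

lemma expectedLoss_pureThen (hβ : |β| < 1) (b : Fin n) (σ : Fin m × Fin n → Strategy m n n) :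
    expectedLoss β r πA (pureThen b σ) = stageLoss β r (πA [])
      (fun a b => expectedLoss β r (continuation πA [(a, b)]) (σ (a, b))) b := by
  have hcont (c : Fin m × Fin n) : continuation (pureThen b σ) [c] = σ c := rfl
  have hfirst (b' : Fin n) : pureThen b σ [] b' = if b' = b then 1 else 0 := Pi.single_apply ..
  rw [expectedLoss_eq_sum_stageLoss hβ]
  simp only [hcont, hfirst, ite_smul, one_smul, zero_smul, Finset.sum_ite_eq', Finset.mem_univ,
    if_true]

/-- The set of all guarantee vectors of strategies of Alice, whose lower frontier is
`optimalFrontier`. -/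
def guaranteeSet (β : ℝ) (r : Fin m → Fin n → Fin K → ℝ) : Set (Fin K → ℝ) :=
  {w | ∃ πA : Strategy m n m, IsGuarantee β r πA w}

lemma guaranteeSet_subset_Icc (hβ : β ∈ Set.Ico (0 : ℝ) 1)
    (hr : ∀ a b k, r a b k ∈ Set.Icc 0 (1 - β)) : guaranteeSet β r ⊆ Set.Icc 0 1 := by
  rintro w ⟨πA, hw⟩
  choose πB hπB using fun k => (hw k).1
  exact ⟨fun k => hπB k ▸ (expectedLoss_mem_Icc hβ hr πA (πB k)).1 k,
    fun k => hπB k ▸ (expectedLoss_mem_Icc hβ hr πA (πB k)).2 k⟩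

theorem guaranteeSet_subset_greatestUpset [NeZero n] (hβ : β ∈ Set.Ico (0 : ℝ) 1)
    (hr : ∀ a b k, r a b k ∈ Set.Icc 0 (1 - β)) : guaranteeSet β r ⊆ greatestUpset β r := by
  refine subset_greatestUpset fun w hw => ?_
  have ⟨πA, hπA⟩ := hw
  have hβ' := abs_lt_one_of_mem_Ico hβ
  choose R hR using fun a b => exists_isGuarantee hβ' r (continuation πA [(a, b)])
  refine mem_upset_dpSet.2 ⟨guaranteeSet_subset_Icc hβ hr hw, πA [], R, fun a b => ⟨_, hR a b⟩,
    fun b k => ?_⟩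
  choose best hbest using fun c : Fin m × Fin n => (hR c.1 c.2 k).1
  have hresponse : expectedLoss β r πA (pureThen b best) k = stageLoss β r (πA []) R b k := by
    rw [expectedLoss_pureThen hβ']
    exact Finset.sum_congr rfl fun a _ => by rw [← hbest (a, b)]
  exact hresponse ▸ (hπA k).2 ⟨_, rfl⟩

end RepeatedGame

section Parametrization

variable {S V : Set (Fin K → ℝ)}

lemma isCompact_paramSet : IsCompact (paramSet K) := by
  have h : paramSet K = (Set.univ.pi fun _ => Set.Icc 0 1) ∩ ⋃ k, {p | p k = 0} := by
    ext p
    simp [paramSet, Pi.le_def, forall_and]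
  rw [h]
  exact (isCompact_univ_pi fun _ => isCompact_Icc).inter_right
    (isClosed_iUnion_of_finite fun k => isClosed_eq (continuous_apply k) continuous_const)

lemma feasibleShifts_upset (hS : S ⊆ Set.Icc 0 1) (p : Fin K → ℝ) :
    feasibleShifts p (upset S) = feasibleShifts p S := by
  ext t
  constructor
  · rintro ⟨u, ⟨-, v, hv, hvu⟩, hut⟩
    exact ⟨v, hv, fun k => (hvu k).trans (hut k)⟩
  · rintro ⟨u, hu, hut⟩
    exact ⟨u, subset_upset hS hu, hut⟩

lemma exists_isLeast_feasibleShifts [NeZero K] (hS : IsCompact S) (hne : S.Nonempty)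
    (p : Fin K → ℝ) : ∃ t, IsLeast (feasibleShifts p S) t := by
  let shift (u : Fin K → ℝ) : ℝ := Finset.univ.sup' Finset.univ_nonempty fun k => u k - p k
  have hshift : Continuous shift := .finset_sup'_apply _ fun k _ => by fun_prop
  obtain ⟨u, hu, hmin⟩ := hS.exists_isMinOn hne hshift.continuousOn
  refine ⟨shift u, ⟨u, hu, fun k => ?_⟩, ?_⟩
  · exact sub_le_iff_le_add.1 (Finset.le_sup' (fun k => u k - p k) (Finset.mem_univ k))
  · rintro t ⟨v, hv, hvt⟩
    exact (hmin hv).trans (Finset.sup'_le _ _ fun k _ => sub_le_iff_le_add.2 (hvt k))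

lemma isLeast_feasibleShifts [NeZero K] (hV : V ∈ frontierSpace K) (p : Fin K → ℝ) :
    IsLeast (feasibleShifts p V) (sInf (feasibleShifts p V)) := by
  obtain ⟨hne, hcube, -, hclosed, -⟩ := hV
  obtain ⟨t, ht⟩ := exists_isLeast_feasibleShifts (isCompact_upset hclosed)
    (hne.mono (subset_upset hcube)) p
  rw [feasibleShifts_upset hcube] at ht
  rwa [ht.csInf_eq]

lemma exists_le_paramPoint [NeZero K] (hV : V ∈ frontierSpace K) (p : Fin K → ℝ) :
    ∃ u ∈ V, u ≤ paramPoint p V :=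
  (isLeast_feasibleShifts hV p).1

lemma paramPoint_nonneg [NeZero K] (hV : V ∈ frontierSpace K) (p : Fin K → ℝ) :
    0 ≤ paramPoint p V := by
  obtain ⟨u, hu, hup⟩ := exists_le_paramPoint hV p
  exact (hV.2.1 hu).1.trans hup

lemma paramPoint_eq_of_add [NeZero K] (hV : ∀ u ∈ V, ∀ v ∈ V, u ≤ v → u = v)
    {u p : Fin K → ℝ} (hu : u ∈ V) {t : ℝ} (h : ∀ k, u k = t + p k) : paramPoint p V = u := by
  have ht : IsLeast (feasibleShifts p V) t := by
    refine ⟨⟨u, hu, fun k => (h k).le⟩, ?_⟩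
    rintro s ⟨v, hv, hvs⟩
    by_contra! hst
    obtain rfl := hV v hv u hu fun k => by linarith [hvs k, h k]
    linarith [hvs 0, h 0]
  ext k
  rw [paramPoint, ht.csInf_eq, h k]

theorem existsUnique_paramPoint_eq [NeZero K] (hV : V ∈ frontierSpace K) {u : Fin K → ℝ}
    (hu : u ∈ V) : ∃! p : paramSet K, paramPoint (p : Fin K → ℝ) V = u := by
  obtain ⟨i, hi⟩ := Finite.exists_min u
  obtain ⟨hu0, hu1⟩ := hV.2.1 hu
  have hmem : (fun k => u k - u i) ∈ paramSet K :=
    ⟨fun k => ⟨sub_nonneg.2 (hi k), (sub_le_self _ (hu0 i)).trans (hu1 k)⟩, i, sub_self _⟩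
  refine ⟨⟨_, hmem⟩, paramPoint_eq_of_add hV.2.2.1 hu (t := u i) fun k => by ring, ?_⟩
  rintro ⟨p, hp, j, hj⟩ rfl
  have hshift : paramPoint p V i = sInf (feasibleShifts p V) := by
    have hij : paramPoint p V i ≤ paramPoint p V j := hi j
    simp only [paramPoint, hj] at hij ⊢
    linarith [(hp i).1]
  ext k
  exact eq_sub_of_add_eq' (by rw [hshift, paramPoint])

theorem stateBound_eq [NeZero n] {β : ℝ} {r : Fin m → Fin n → Fin K → ℝ}
    {α : paramSet K → stdSimplex ℝ (Fin m)} {q : Fin n → paramSet K → paramSet K}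
    {p : paramSet K} :
    stateBound β r V α q p = Finset.univ.sup' Finset.univ_nonempty
      (stageLoss β r (α p) fun _ b => paramPoint (q b p : Fin K → ℝ) V) := by
  ext k
  simp only [stateBound, Finset.sup'_apply,
    stageLoss_const fun b => paramPoint (q b p : Fin K → ℝ) V]

theorem exists_stationary_data [NeZero n] [NeZero K] {β : ℝ} {r : Fin m → Fin n → Fin K → ℝ}
    (hβ : 0 ≤ β) (hV : V ∈ frontierSpace K) (hfix : dpOperator β r V = V) :
    ∃ (α : paramSet K → stdSimplex ℝ (Fin m)) (q : Fin n → paramSet K → paramSet K),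
      (∀ p, stateBound β r V α q p ≤ paramPoint (p : Fin K → ℝ) V) ∧
      ∀ b p, paramPoint (q b p : Fin K → ℝ) V ∈ V := by
  have hpoint (p : paramSet K) : ∃ (α : stdSimplex ℝ (Fin m)) (R : Fin m → Fin n → Fin K → ℝ),
      (∀ a b, R a b ∈ V) ∧ ∀ b, stageLoss β r α R b ≤ paramPoint (p : Fin K → ℝ) V := by
    obtain ⟨u, hu, hup⟩ := exists_le_paramPoint hV (p : Fin K → ℝ)
    obtain ⟨α, R, hR, rfl⟩ := mem_dpSet.1 (hfix.ge hu).1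
    exact ⟨α, R, hR, fun b => (Finset.le_sup' _ (Finset.mem_univ b)).trans hup⟩
  choose α R hR hle using hpoint
  -- By convexity, the continuations after Bob's action `b` may be replaced by their average.
  have haverage (b : Fin n) (p : paramSet K) : ∃ q : paramSet K,
      paramPoint (q : Fin K → ℝ) V ∈ V ∧
        paramPoint (q : Fin K → ℝ) V ≤ ∑ a, α p a • R p a b := by
    obtain ⟨-, v, hv, hvle⟩ := hV.2.2.2.2.sum_mem (fun a _ => (α p).2.1 a) (α p).2.2
      fun a _ => subset_upset hV.2.1 (hR p a b)
    obtain ⟨q, rfl, -⟩ := existsUnique_paramPoint_eq hV hv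
    exact ⟨q, hv, hvle⟩
  choose q hqV hq using haverage
  refine ⟨α, q, fun p => ?_, hqV⟩
  rw [stateBound_eq]
  refine Finset.sup'_le _ _ fun b _ => ?_
  calc stageLoss β r (α p) (fun _ b => paramPoint (q b p : Fin K → ℝ) V) b
      ≤ stageLoss β r (α p) (fun _ b => ∑ a, α p a • R p a b) b :=
        stageLoss_mono hβ fun _ => hq b p
    _ = stageLoss β r (α p) (R p) b := stageLoss_average
    _ ≤ paramPoint (p : Fin K → ℝ) V := hle p b

end Parametrization

section Stationary

variable {β : ℝ} {r : Fin m → Fin n → Fin K → ℝ} {V : Set (Fin K → ℝ)}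
  {α : paramSet K → stdSimplex ℝ (Fin m)} {q : Fin n → paramSet K → paramSet K}

lemma continuation_stationary (α : paramSet K → stdSimplex ℝ (Fin m))
    (q : Fin n → paramSet K → paramSet K) (p : paramSet K) (h : List (Fin m × Fin n)) :
    continuation (stationary α q p) h = stationary α q (stateAfter q p h) := by
  funext h'
  simp only [continuation, stationary, stateAfter, List.foldl_append]

lemma stationary_eq_of_map_snd_eq (p : paramSet K) {h h' : List (Fin m × Fin n)}
    (heq : h.map Prod.snd = h'.map Prod.snd) : stationary α q p h = stationary α q p h' := by
  have hfold (l : List (Fin m × Fin n)) :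
      stateAfter q p l = (l.map Prod.snd).foldl (fun s b => q b s) p := by
    rw [stateAfter, List.foldl_map]
  rw [stationary, stationary, hfold, hfold, heq]

variable [NeZero n]

lemma stageLoss_le_stateBound (p : paramSet K) (b : Fin n) :
    stageLoss β r (α p) (fun _ b => paramPoint (q b p : Fin K → ℝ) V) b ≤
      stateBound β r V α q p := by
  rw [stateBound_eq]
  exact Finset.le_sup' _ (Finset.mem_univ b)

theorem expectedLoss_stationary_le [NeZero K] (hβ : β ∈ Set.Ico (0 : ℝ) 1)
    (hr : ∀ a b k, r a b k ∈ Set.Icc 0 (1 - β)) (hV : V ∈ frontierSpace K)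
    (hq : ∀ p, stateBound β r V α q p ≤ paramPoint (p : Fin K → ℝ) V)
    (p : paramSet K) (πB : Strategy m n n) :
    expectedLoss β r (stationary α q p) πB ≤ paramPoint (p : Fin K → ℝ) V :=
  expectedLoss_le_of_stageLoss_le hβ hr (fun p c => continuation_stationary α q p [c])
    (v := fun p => paramPoint (p : Fin K → ℝ) V) (fun p => paramPoint_nonneg hV p)
    (fun p b => (stageLoss_le_stateBound p b).trans (hq p)) p πB

lemma expectedLoss_stationary_le_stateBound [NeZero K] (hβ : β ∈ Set.Ico (0 : ℝ) 1)
    (hr : ∀ a b k, r a b k ∈ Set.Icc 0 (1 - β)) (hV : V ∈ frontierSpace K)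
    (hq : ∀ p, stateBound β r V α q p ≤ paramPoint (p : Fin K → ℝ) V)
    (p : paramSet K) (πB : Strategy m n n) :
    expectedLoss β r (stationary α q p) πB ≤ stateBound β r V α q p :=
  expectedLoss_le_of_continuation hβ
    (fun a b => by
      rw [continuation_stationary]
      exact expectedLoss_stationary_le hβ hr hV hq (q b p) _)
    fun b => stageLoss_le_stateBound p b

lemma exists_mem_le_of_mem_guaranteeSet (hβ : β ∈ Set.Ico (0 : ℝ) 1)
    (hr : ∀ a b k, r a b k ∈ Set.Icc 0 (1 - β)) (hV : V ∈ frontierSpace K)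
    (hfix : dpOperator β r V = V) {w : Fin K → ℝ} (hw : w ∈ guaranteeSet β r) :
    ∃ v ∈ V, v ≤ w := by
  have hmem := guaranteeSet_subset_greatestUpset hβ hr hw
  rw [← (dpOperator_eq_self_iff hβ hr hV).1 hfix] at hmem
  exact hmem.2

theorem isGuarantee_stationary [NeZero K] (hβ : β ∈ Set.Ico (0 : ℝ) 1)
    (hr : ∀ a b k, r a b k ∈ Set.Icc 0 (1 - β)) (hV : V ∈ frontierSpace K)
    (hfix : dpOperator β r V = V)
    (hq : ∀ p, stateBound β r V α q p ≤ paramPoint (p : Fin K → ℝ) V)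
    {p : paramSet K} (hp : paramPoint (p : Fin K → ℝ) V ∈ V) :
    IsGuarantee β r (stationary α q p) (paramPoint (p : Fin K → ℝ) V) := by
  obtain ⟨w, hw⟩ := exists_isGuarantee (abs_lt_one_of_mem_Ico hβ) r (stationary α q p)
  have hwp : w ≤ paramPoint (p : Fin K → ℝ) V := fun k => by
    obtain ⟨πB, hπB⟩ := (hw k).1
    exact hπB ▸ expectedLoss_stationary_le hβ hr hV hq p πB k
  obtain ⟨v, hv, hvw⟩ := exists_mem_le_of_mem_guaranteeSet hβ hr hV hfix ⟨_, hw⟩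
  obtain rfl := hV.2.2.1 v hv _ hp (hvw.trans hwp)
  rwa [← hwp.antisymm hvw]

theorem paramPoint_eq_stateBound [NeZero K] (hβ : β ∈ Set.Ico (0 : ℝ) 1)
    (hr : ∀ a b k, r a b k ∈ Set.Icc 0 (1 - β)) (hV : V ∈ frontierSpace K)
    (hfix : dpOperator β r V = V)
    (hq : ∀ p, stateBound β r V α q p ≤ paramPoint (p : Fin K → ℝ) V)
    {p : paramSet K} (hp : paramPoint (p : Fin K → ℝ) V ∈ V) :
    paramPoint (p : Fin K → ℝ) V = stateBound β r V α q p := by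
  refine le_antisymm (fun k => ?_) (hq p)
  obtain ⟨πB, hπB⟩ := (isGuarantee_stationary hβ hr hV hfix hq hp k).1
  exact hπB ▸ expectedLoss_stationary_le_stateBound hβ hr hV hq p πB k

theorem fixedPoint_eq_optimalFrontier [NeZero K] (hβ : β ∈ Set.Ico (0 : ℝ) 1)
    (hr : ∀ a b k, r a b k ∈ Set.Icc 0 (1 - β)) (hV : V ∈ frontierSpace K)
    (hfix : dpOperator β r V = V) : V = optimalFrontier β r := by
  obtain ⟨α, q, hq, -⟩ := exists_stationary_data hβ.1 hV hfix
  have hsub : V ⊆ guaranteeSet β r := fun v hv => by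
    obtain ⟨p, rfl, -⟩ := existsUnique_paramPoint_eq hV hv
    exact ⟨_, isGuarantee_stationary hβ hr hV hfix hq hv⟩
  calc V = lowerFrontier V := (lowerFrontier_eq_self hV.2.2.1).symm
    _ = lowerFrontier (guaranteeSet β r) := lowerFrontier_eq_of_subset hsub fun w hw =>
        exists_mem_le_of_mem_guaranteeSet hβ hr hV hfix hw

end Stationary

end VectorGame

theorem theorem3 {m n K : ℕ} [NeZero m] [NeZero n] [NeZero K]
    (β : ℝ) (hβ : β ∈ Set.Ico (0 : ℝ) 1)
    (r : Fin m → Fin n → Fin K → ℝ) (hr : ∀ a b k, r a b k ∈ Set.Icc 0 (1 - β)) :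
    -- the state space is compact
    IsCompact (paramSet K) ∧
    -- the fixed point of the dynamic programming operator exists and is unique
    (∃! V : Set (Fin K → ℝ), V ∈ frontierSpace K ∧ dpOperator β r V = V) ∧
    ∀ V ∈ frontierSpace K, dpOperator β r V = V →
      -- it is the set of optimal guarantees of the infinitely repeated game
      V = optimalFrontier β r ∧
      -- it is parametrized by the state space
      (∀ p : paramSet K, IsLeast (feasibleShifts (p : Fin K → ℝ) V)
        (sInf (feasibleShifts (p : Fin K → ℝ) V))) ∧
      (∀ u ∈ V, ∃! p : paramSet K, paramPoint (p : Fin K → ℝ) V = u) ∧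
      -- mixed actions and transitions as required exist
      (∃ (α : paramSet K → stdSimplex ℝ (Fin m)) (q : Fin n → paramSet K → paramSet K),
        (∀ p k, stateBound β r V α q p k ≤ paramPoint (p : Fin K → ℝ) V k) ∧
        ∀ b p, paramPoint (q b p : Fin K → ℝ) V ∈ V) ∧
      -- and all of them yield stationary strategies with the bounds claimed
      ∀ (α : paramSet K → stdSimplex ℝ (Fin m)) (q : Fin n → paramSet K → paramSet K),
        (∀ p k, stateBound β r V α q p k ≤ paramPoint (p : Fin K → ℝ) V k) →
        ∀ p₁ : paramSet K,
          -- the loss never exceeds the bound of the initial state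
          (∀ (πB : Strategy m n n) (k : Fin K),
            expectedLoss β r (stationary α q p₁) πB k ≤ paramPoint (p₁ : Fin K → ℝ) V k) ∧
          -- after every history, what follows is bounded by the bound of the current state
          (∀ (h : List (Fin m × Fin n)) (πB : Strategy m n n) (k : Fin K),
            expectedLoss β r (continuation (stationary α q p₁) h) πB k ≤
              paramPoint (stateAfter q p₁ h : Fin K → ℝ) V k) ∧
          -- on the frontier the bounds are exact
          (paramPoint (p₁ : Fin K → ℝ) V ∈ V →
            (∀ k, paramPoint (p₁ : Fin K → ℝ) V k = stateBound β r V α q p₁ k) ∧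
            IsGuarantee β r (stationary α q p₁) (paramPoint (p₁ : Fin K → ℝ) V)) ∧
          -- Alice's own past actions are ignored
          (∀ h h' : List (Fin m × Fin n), h.map Prod.snd = h'.map Prod.snd →
            stationary α q p₁ h = stationary α q p₁ h') := by
  refine ⟨isCompact_paramSet, existsUnique_fixedPoint hβ hr, fun V hV hfix =>
    ⟨fixedPoint_eq_optimalFrontier hβ hr hV hfix, fun p => isLeast_feasibleShifts hV p,
      fun u hu => existsUnique_paramPoint_eq hV hu, exists_stationary_data hβ.1 hV hfix,
      fun α q hq p₁ => ⟨expectedLoss_stationary_le hβ hr hV hq p₁, fun h πB => ?_, fun hp =>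
        ⟨congrFun (paramPoint_eq_stateBound hβ hr hV hfix hq hp),
          isGuarantee_stationary hβ hr hV hfix hq hp⟩,
        fun h h' => stationary_eq_of_map_snd_eq p₁⟩⟩⟩
  rw [continuation_stationary]
  exact expectedLoss_stationary_le hβ hr hV hq _ πB
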